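/- Let $\mu$ be the uniform distribution on the unit circle $\{z\in\mathbb{C}:|z|=1\}$, regarded as a Borel probability measure on $\mathbb{C}$, and let $Z_1,Z_2,\dots$ be independent complex-valued random variables on a probability space $(\Omega,\mathbb{P})$, each with law $\mu$. Fix an integer $k\ge 1$. For $n\ge k+1$ and $\omega\in\Omega$ let $$P_n(\omega)(z)=(z-Z_1(\omega))\cdots(z-Z_n(\omega)),$$ let $W^{(k)}_{n,1}(\omega),\dots,W^{(k)}_{n,n-k}(\omega)$ be the zeros, counted with multiplicity, of the $k$-th derivative $P_n(\omega)^{(k)}$, and let $$\mu^{(k)}_n(\omega)=\frac{1}{n-k}\sum_{j=1}^{n-k}\delta_{W^{(k)}_{n,j}(\omega)}$$ be their empirical measure, where $\delta_w$ is the Dirac measure at $w$. Then almost surely $\mu^{(k)}_n$ converges weakly to $\mu$ as $n\to\infty$; that is, for $\mathbb{P}$-almost every $\omega$, the probability measures $\mu^{(k)}_n(\omega)$ on $\mathbb{C}$ converge weakly to $\mu$. -/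

import Mathlib

open MeasureTheory ProbabilityTheory Filter Topology Polynomial

noncomputable section

/-- The uniform distribution on the unit circle, as a probability measure on `ℂ`: the law of
`exp (i θ)` where `θ` is uniformly distributed on `(0, 2π]`. -/
def uniformCircle : ProbabilityMeasure ℂ :=
  ⟨(volume[|Set.Ioc (0 : ℝ) (2 * Real.pi)]).map (fun θ : ℝ => Complex.exp (θ * Complex.I)), by
    have h : IsProbabilityMeasure (volume[|Set.Ioc (0 : ℝ) (2 * Real.pi)]) := by
      apply cond_isProbabilityMeasure_of_finite
      · simp [Real.pi_pos]
      · exact measure_Ioc_lt_top.ne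
    exact Measure.isProbabilityMeasure_map (by fun_prop)⟩

/-- The random polynomial `P_n(ω)(z) = (z - Z_0(ω)) ⋯ (z - Z_{n-1}(ω))`. -/
def randomPoly {Ω : Type*} (Z : ℕ → Ω → ℂ) (n : ℕ) (ω : Ω) : ℂ[X] :=
  ∏ i ∈ Finset.range n, (X - C (Z i ω))

/-- The zeros in `ℂ`, counted with multiplicity, of the `k`-th derivative of `P_n(ω)`. -/
def derivZeros {Ω : Type*} (Z : ℕ → Ω → ℂ) (k n : ℕ) (ω : Ω) : Multiset ℂ :=
  (derivative^[k] (randomPoly Z n ω)).roots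

theorem card_derivZeros {Ω : Type*} (Z : ℕ → Ω → ℂ) (k n : ℕ) (ω : Ω) :
    Multiset.card (derivZeros Z k n ω) = n - k := by
  have hd : ∀ j : ℕ, (derivative^[j] (randomPoly Z n ω)).natDegree = n - j := by
    intro j
    induction j with
    | zero => simp [randomPoly]
    | succ j ih =>
      rw [Function.iterate_succ_apply', natDegree_derivative, ih, Nat.sub_sub]
  rw [derivZeros, ← (IsAlgClosed.splits _).natDegree_eq_card_roots, hd]

/-- The empirical measure `(n - k)⁻¹ ∑_j δ_{W_j}` of the `n - k` zeros `W_j`, counted with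
multiplicity, of the `k`-th derivative of `P_n(ω)`, for `k < n`. -/
def empiricalMeasure {Ω : Type*} (Z : ℕ → Ω → ℂ) (k n : ℕ) (hkn : k < n) (ω : Ω) :
    ProbabilityMeasure ℂ :=
  ⟨((n - k : ℕ) : ENNReal)⁻¹ • ((derivZeros Z k n ω).map Measure.dirac).sum, by
    have key : ∀ s : Multiset ℂ,
        (s.map Measure.dirac).sum Set.univ = (Multiset.card s : ENNReal) := by
      intro s
      induction s using Multiset.induction_on with
      | empty => simp
      | cons a s ih => simp [ih, add_comm]
    constructor
    rw [Measure.smul_apply, key, card_derivZeros, smul_eq_mul]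
    apply ENNReal.inv_mul_cancel
    · exact_mod_cast (Nat.sub_pos_of_lt hkn).ne'
    · exact ENNReal.natCast_ne_top _⟩

end

/-!
A polynomial `p` of degree `n` with zeros in the unit disc and its derivative have power sums of
zeros that differ by a bound independent of `n`: Newton's identities express `n` times the `m`-th
difference through products of power sums, each at most `n`, with earlier differences. Hence the
holomorphic moments of the zeros of `P_n^(k)` have the same limits as those of `Z_0, …, Z_{n-1}`,
which the strong law of large numbers provides. Holomorphic moments do not determine a limit on the
disc, so one also needs that the zeros of `P_n^(k)`, which lie in the disc by Gauss–Lucas, approach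
the circle on average. Up to a factor of at most `n ^ k`, the `k`-th coefficient of `P_n` bounds the
modulus of their product from below, and it is almost surely not exponentially small, by the
recursion `c_{n+1,k+1} = c_{n,k} - Z_n c_{n,k+1}` together with the independence and
anti-concentration of `Z_n`. On the circle `z ^ a * conj z ^ b` reduces to a power of `z` or of
`conj z`, so all mixed moments converge, and Stone–Weierstrass on the disc gives weak convergence.
-/

section PowerSums

variable {R : Type*} [CommRing R]

/-- The `m`-th power sum of a multiset of ring elements, counted with multiplicity. For the zeros of
a polynomial it is an unnormalized holomorphic moment. -/
def powerSum (s : Multiset R) (m : ℕ) : R := (s.map (· ^ m)).sum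

/-- The generating series of the power sums of a multiset, including the zeroth one. It turns
Newton's identities into an identity of power series. -/
def powerSumSeries (s : Multiset R) : PowerSeries R := PowerSeries.mk (powerSum s)

theorem powerSum_zero_right (s : Multiset R) : powerSum s 0 = Multiset.card s := by
  simp [powerSum]

theorem powerSumSeries_cons (a : R) (s : Multiset R) :
    powerSumSeries (a ::ₘ s) = PowerSeries.mk (a ^ ·) + powerSumSeries s := by
  ext m
  simp [powerSumSeries, powerSum]

theorem norm_powerSum_le_card {K : Type*} [NormedField K] {s : Multiset K}
    (hs : ∀ a ∈ s, ‖a‖ ≤ 1) (m : ℕ) : ‖powerSum s m‖ ≤ Multiset.card s := by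
  have hpow : ∀ x ∈ (s.map (· ^ m)).map (‖·‖), x ≤ 1 := by
    simpa using fun a ha => pow_le_one₀ (norm_nonneg a) (hs a ha)
  simpa [powerSum] using (norm_multiset_sum_le _).trans (Multiset.sum_le_card_nsmul _ 1 hpow)

theorem one_sub_C_mul_X_mul_mk_pow (a : R) :
    (1 - PowerSeries.C a * PowerSeries.X) * PowerSeries.mk (a ^ ·) = 1 := by
  ext (_ | n)
  · simp [sub_mul, mul_assoc]
  · simp [sub_mul, mul_assoc, PowerSeries.coeff_succ_X_mul, PowerSeries.coeff_one, pow_succ']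

end PowerSums

section Reverse

variable {R : Type*} [CommRing R]

theorem reverse_X_sub_C [Nontrivial R] (a : R) : (X - C a : R[X]).reverse = 1 - C a * X := by
  ext n
  rw [coeff_reverse, natDegree_X_sub_C]
  rcases n with _ | _ | n
  · simp [revAt_le]
  · simp [revAt_le, coeff_one]
  · rw [revAt_eq_self_of_lt (by lia)]
    simp [coeff_X, coeff_one]

theorem reverse_derivative [IsAddTorsionFree R] (p : R[X]) :
    p.derivative.reverse = (p.natDegree : R[X]) * p.reverse - X * derivative p.reverse := by
  have hX (q : R[X]) (j : ℕ) : (X * derivative q).coeff j = j * q.coeff j := by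
    rcases j with _ | j
    · simp
    · rw [coeff_X_mul, coeff_derivative, mul_comm, Nat.cast_succ]
  by_cases h0 : p.natDegree = 0
  · obtain ⟨c, rfl⟩ := natDegree_eq_zero.1 h0
    simp
  ext j
  rw [coeff_sub, coeff_natCast_mul, hX, coeff_reverse, coeff_reverse, natDegree_derivative]
  rcases lt_or_ge j p.natDegree with hj | hj
  · obtain ⟨d, hd⟩ := Nat.exists_eq_add_of_lt hj
    rw [revAt_le (by lia), revAt_le hj.le, coeff_derivative, hd,
      show j + d + 1 - 1 - j = d by lia, show j + d + 1 - j = d + 1 by lia]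
    push_cast
    ring
  · rw [revAt_eq_self_of_lt (by lia), coeff_derivative, coeff_eq_zero_of_natDegree_lt (by lia)]
    rcases hj.eq_or_lt with rfl | hj
    · ring
    · rw [revAt_eq_self_of_lt hj, coeff_eq_zero_of_natDegree_lt hj]
      ring

variable {K : Type*} [Field K]

theorem reverse_mul_powerSumSeries_roots_sub {p : K[X]} (hp : p.Splits) :
    (p.reverse : PowerSeries K) * (powerSumSeries p.roots - (p.natDegree : PowerSeries K)) =
      -(PowerSeries.X * PowerSeries.derivative K (p.reverse : PowerSeries K)) := by
  have key (s : Multiset K) :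
      ((s.map (X - C ·)).prod.reverse : PowerSeries K) *
        (powerSumSeries s - (Multiset.card s : PowerSeries K)) =
      -(PowerSeries.X * PowerSeries.derivative K
        ((s.map (X - C ·)).prod.reverse : PowerSeries K)) := by
    induction s using Multiset.induction_on with
    | empty =>
      have : (1 : K[X]).reverse = 1 := reverse_C 1
      simp [this, powerSumSeries, powerSum, PowerSeries.ext_iff]
    | cons a s ih =>
      simp only [Multiset.map_cons, Multiset.prod_cons, reverse_mul_of_domain, reverse_X_sub_C,
        powerSumSeries_cons, Multiset.card_cons, coe_mul, coe_sub, coe_one, coe_C, coe_X,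
        Derivation.leibniz, map_sub, PowerSeries.derivative_C, PowerSeries.derivative_X,
        Derivation.map_one_eq_zero, smul_eq_mul, Nat.cast_succ]
      linear_combination (1 - PowerSeries.C a * PowerSeries.X) * ih +
        ((s.map (X - C ·)).prod.reverse : PowerSeries K) * one_sub_C_mul_X_mul_mk_pow a
  have hrev : (p.reverse : PowerSeries K) =
      PowerSeries.C p.leadingCoeff * ((p.roots.map (X - C ·)).prod.reverse : PowerSeries K) := by
    conv_lhs => rw [hp.eq_prod_roots]
    rw [reverse_mul_of_domain, reverse_C, coe_mul, coe_C]
  rw [hrev, hp.natDegree_eq_card_roots, Derivation.leibniz, PowerSeries.derivative_C, smul_zero,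
    add_zero, smul_eq_mul, mul_assoc, key]
  ring

variable [CharZero K]

theorem reverse_derivative_eq_mul_powerSumSeries {p : K[X]} (hp : p.Splits) :
    (p.derivative.reverse : PowerSeries K) = p.reverse * powerSumSeries p.roots := by
  rw [reverse_derivative]
  simp only [coe_sub, coe_mul, coe_X, ← PowerSeries.derivative_coe]
  have hcast : ((p.natDegree : K[X]) : PowerSeries K) = p.natDegree :=
    map_natCast coeToPowerSeries.ringHom _
  linear_combination hcast * (p.reverse : PowerSeries K) - reverse_mul_powerSumSeries_roots_sub hp

theorem powerSumSeries_roots_mul_sub {p : K[X]} (hp : p.Splits) (hp' : p.derivative.Splits)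
    (hdeg : p.natDegree ≠ 0) :
    powerSumSeries p.roots * (powerSumSeries p.roots - powerSumSeries p.derivative.roots - 1) =
      PowerSeries.X * PowerSeries.derivative K (powerSumSeries p.roots) := by
  have hp0 : (p.reverse : PowerSeries K) ≠ 0 := by
    rw [Ne, coe_eq_zero_iff, reverse_eq_zero]
    rintro rfl
    exact hdeg natDegree_zero
  have hcast : ((p.natDegree - 1 : ℕ) : PowerSeries K) = p.natDegree - 1 := by
    rw [Nat.cast_pred (Nat.pos_of_ne_zero hdeg)]
  have h := reverse_mul_powerSumSeries_roots_sub hp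
  have h' := reverse_mul_powerSumSeries_roots_sub hp'
  rw [reverse_derivative_eq_mul_powerSumSeries hp, Derivation.leibniz, natDegree_derivative,
    hcast, smul_eq_mul, smul_eq_mul] at h'
  refine mul_left_cancel₀ hp0 ?_
  linear_combination powerSumSeries p.roots * h - h'

theorem powerSum_roots_zero_sub {p : K[X]} (hp : p.Splits) (hp' : p.derivative.Splits)
    (hdeg : p.natDegree ≠ 0) : powerSum p.roots 0 - powerSum p.derivative.roots 0 = 1 := by
  rw [powerSum_zero_right, powerSum_zero_right, ← hp.natDegree_eq_card_roots,
    ← hp'.natDegree_eq_card_roots, natDegree_derivative, Nat.cast_pred (Nat.pos_of_ne_zero hdeg)]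
  ring

theorem sum_powerSum_mul_powerSum_roots_sub {p : K[X]} (hp : p.Splits) (hp' : p.derivative.Splits)
    (hdeg : p.natDegree ≠ 0) (m : ℕ) :
    ∑ i ∈ Finset.range m, powerSum p.roots i *
      (powerSum p.roots (m - i) - powerSum p.derivative.roots (m - i)) =
      m * powerSum p.roots m := by
  have h := congrArg (PowerSeries.coeff m) (powerSumSeries_roots_mul_sub hp hp' hdeg)
  have hX : PowerSeries.coeff m (PowerSeries.X * PowerSeries.derivative K
      (powerSumSeries p.roots)) = m * powerSum p.roots m := by
    rcases m with _ | m
    · simp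
    · simp [PowerSeries.coeff_succ_X_mul, PowerSeries.coeff_derivative, powerSumSeries, mul_comm]
  rw [hX, PowerSeries.coeff_mul, Finset.Nat.sum_antidiagonal_eq_sum_range_succ_mk,
    Finset.sum_range_succ] at h
  rw [← h]
  simp only [powerSumSeries, map_sub, PowerSeries.coeff_mk, PowerSeries.coeff_one, tsub_self,
    powerSum_roots_zero_sub hp hp' hdeg, if_true, sub_self, mul_zero, add_zero]
  refine Finset.sum_congr rfl fun i hi => ?_
  rw [if_neg (Nat.sub_ne_zero_of_lt (Finset.mem_range.1 hi)), sub_zero]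

theorem natDegree_mul_powerSum_roots_sub {p : K[X]} (hp : p.Splits) (hp' : p.derivative.Splits)
    (hdeg : p.natDegree ≠ 0) (m : ℕ) :
    p.natDegree * (powerSum p.roots (m + 1) - powerSum p.derivative.roots (m + 1)) =
      (m + 1 : ℕ) * powerSum p.roots (m + 1) -
        ∑ i ∈ Finset.range m, powerSum p.roots (i + 1) *
          (powerSum p.roots (m - i) - powerSum p.derivative.roots (m - i)) := by
  have h := sum_powerSum_mul_powerSum_roots_sub hp hp' hdeg (m + 1)
  rw [Finset.sum_range_succ', powerSum_zero_right, ← hp.natDegree_eq_card_roots] at h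
  simp only [Nat.add_sub_add_right, Nat.sub_zero] at h
  linear_combination h

end Reverse

theorem natDegree_iterate_derivative_eq {R : Type*} [Semiring R] [IsAddTorsionFree R]
    (p : R[X]) (k : ℕ) : (derivative^[k] p).natDegree = p.natDegree - k := by
  induction k with
  | zero => rfl
  | succ k ih => rw [Function.iterate_succ_apply', natDegree_derivative, ih, Nat.sub_sub]

section RootsOfDerivatives

theorem add_sum_two_pow_sub_one_le (m : ℕ) :
    (m + 1 : ℝ) + ∑ i ∈ Finset.range m, ((2 : ℝ) ^ (m - i + 1) - 1) ≤ 2 ^ (m + 1 + 1) - 1 := by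
  induction m with
  | zero => norm_num
  | succ m ih =>
    rw [Finset.sum_range_succ']
    simp only [Nat.add_sub_add_right, Nat.sub_zero, Nat.cast_succ]
    linear_combination ih

theorem norm_powerSum_roots_sub_le {K : Type*} [RCLike K] {p : K[X]} (hp : p.Splits)
    (hp' : p.derivative.Splits) (hdeg : p.natDegree ≠ 0) (hroots : ∀ a ∈ p.roots, ‖a‖ ≤ 1)
    (m : ℕ) : ‖powerSum p.roots m - powerSum p.derivative.roots m‖ ≤ 2 ^ (m + 1) - 1 := by
  induction m using Nat.strong_induction_on with
  | _ m ih =>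
    rcases m with _ | m
    · rw [powerSum_roots_zero_sub hp hp' hdeg, norm_one]
      norm_num
    set d : ℕ → K := fun i => powerSum p.roots i - powerSum p.derivative.roots i
    have hs (i : ℕ) : ‖powerSum p.roots i‖ ≤ p.natDegree := by
      simpa [hp.natDegree_eq_card_roots] using norm_powerSum_le_card hroots i
    have hn : (0 : ℝ) < p.natDegree := by exact_mod_cast Nat.pos_of_ne_zero hdeg
    have hnewton : (p.natDegree : K) * d (m + 1) = (m + 1 : ℕ) * powerSum p.roots (m + 1) -
        ∑ i ∈ Finset.range m, powerSum p.roots (i + 1) * d (m - i) :=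
      natDegree_mul_powerSum_roots_sub hp hp' hdeg m
    refine le_of_mul_le_mul_left ?_ hn
    calc p.natDegree * ‖d (m + 1)‖
        = ‖(m + 1 : ℕ) * powerSum p.roots (m + 1) -
            ∑ i ∈ Finset.range m, powerSum p.roots (i + 1) * d (m - i)‖ := by
          rw [← hnewton, norm_mul, RCLike.norm_natCast]
      _ ≤ (m + 1 : ℕ) * p.natDegree +
            ∑ i ∈ Finset.range m, p.natDegree * ((2 : ℝ) ^ (m - i + 1) - 1) := by
          refine (norm_sub_le _ _).trans (add_le_add ?_ ((norm_sum_le _ _).trans ?_))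
          · rw [norm_mul, RCLike.norm_natCast]
            exact mul_le_mul_of_nonneg_left (hs _) (Nat.cast_nonneg _)
          · refine Finset.sum_le_sum fun i _ => ?_
            rw [norm_mul]
            exact mul_le_mul (hs _) (ih _ (by lia)) (norm_nonneg _) hn.le
      _ = p.natDegree * ((m + 1 : ℝ) + ∑ i ∈ Finset.range m, ((2 : ℝ) ^ (m - i + 1) - 1)) := by
          rw [← Finset.mul_sum]
          push_cast
          ring
      _ ≤ p.natDegree * (2 ^ (m + 1 + 1) - 1) :=
          mul_le_mul_of_nonneg_left (add_sum_two_pow_sub_one_le m) hn.le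

theorem mem_of_mem_roots_derivative {s : Set ℂ} (hs : Convex ℝ s) {p : ℂ[X]}
    (hp : ∀ a ∈ p.roots, a ∈ s) {a : ℂ} (ha : a ∈ p.derivative.roots) : a ∈ s := by
  have hdeg : 0 < p.degree := by
    by_contra! hdeg
    rw [eq_C_of_degree_le_zero hdeg] at ha
    simp at ha
  refine convexHull_min ?_ hs (rootSet_derivative_subset_convexHull_rootSet hdeg ?_)
  · intro z hz
    exact hp z (by simpa [rootSet] using hz)
  · simpa [rootSet] using ha

theorem mem_of_mem_roots_iterate_derivative {s : Set ℂ} (hs : Convex ℝ s) {p : ℂ[X]}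
    (hp : ∀ a ∈ p.roots, a ∈ s) (k : ℕ) : ∀ a ∈ (derivative^[k] p).roots, a ∈ s := by
  induction k with
  | zero => exact hp
  | succ k ih =>
    rw [Function.iterate_succ_apply']
    exact fun a => mem_of_mem_roots_derivative hs ih

theorem norm_le_one_of_mem_roots_iterate_derivative {p : ℂ[X]} (hp : ∀ a ∈ p.roots, ‖a‖ ≤ 1)
    (k : ℕ) : ∀ a ∈ (derivative^[k] p).roots, ‖a‖ ≤ 1 := by
  simpa using mem_of_mem_roots_iterate_derivative (convex_closedBall 0 1) (by simpa using hp) k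

theorem norm_powerSum_roots_iterate_derivative_sub_le {p : ℂ[X]}
    (hroots : ∀ a ∈ p.roots, ‖a‖ ≤ 1) (m : ℕ) {k : ℕ} (hk : k ≤ p.natDegree) :
    ‖powerSum p.roots m - powerSum (derivative^[k] p).roots m‖ ≤ k * (2 ^ (m + 1) - 1) := by
  induction k with
  | zero => simp
  | succ k ih =>
    have hdeg : (derivative^[k] p).natDegree ≠ 0 := by
      rw [natDegree_iterate_derivative_eq]
      lia
    have hstep := norm_powerSum_roots_sub_le (IsAlgClosed.splits _) (IsAlgClosed.splits _) hdeg
      (norm_le_one_of_mem_roots_iterate_derivative hroots k) m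
    rw [Function.iterate_succ_apply', Nat.cast_succ, add_one_mul]
    exact (norm_sub_le_norm_sub_add_norm_sub _ _ _).trans (add_le_add (ih (by lia)) hstep)

theorem norm_coeff_le_mul_norm_prod_roots_iterate_derivative {p : ℂ[X]} (hp : p.Monic)
    {k : ℕ} (hk : k ≤ p.natDegree) :
    ‖p.coeff k‖ ≤ p.natDegree ^ k * ‖(derivative^[k] p).roots.prod‖ := by
  have h := congrArg norm
    (IsAlgClosed.splits (derivative^[k] p)).coeff_zero_eq_leadingCoeff_mul_prod_roots
  rw [leadingCoeff, natDegree_iterate_derivative_eq, coeff_iterate_derivative,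
    coeff_iterate_derivative, Nat.sub_add_cancel hk, hp.coeff_natDegree, zero_add,
    Nat.descFactorial_self] at h
  simp only [nsmul_eq_mul, norm_mul, Complex.norm_natCast, mul_one, norm_pow, norm_neg, norm_one,
    one_pow, one_mul] at h
  calc ‖p.coeff k‖ ≤ k.factorial * ‖p.coeff k‖ :=
        le_mul_of_one_le_left (norm_nonneg _) (by exact_mod_cast k.factorial_pos)
    _ = p.natDegree.descFactorial k * ‖(derivative^[k] p).roots.prod‖ := h
    _ ≤ p.natDegree ^ k * ‖(derivative^[k] p).roots.prod‖ := by
        gcongr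
        exact_mod_cast Nat.descFactorial_le_pow _ _

theorem norm_multiset_prod_le_exp {K : Type*} [NormedField K] (s : Multiset K) :
    ‖s.prod‖ ≤ Real.exp (-(Multiset.card s - (s.map (‖·‖)).sum)) := by
  induction s using Multiset.induction_on with
  | empty => simp
  | cons a s ih =>
    have ha : ‖a‖ ≤ Real.exp (-(1 - ‖a‖)) := by linarith [Real.add_one_le_exp (-(1 - ‖a‖))]
    calc ‖(a ::ₘ s).prod‖ = ‖a‖ * ‖s.prod‖ := by rw [Multiset.prod_cons, norm_mul]
      _ ≤ Real.exp (-(1 - ‖a‖)) * Real.exp (-(Multiset.card s - (s.map (‖·‖)).sum)) := by gcongr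
      _ = _ := by
          rw [← Real.exp_add, Multiset.card_cons, Multiset.map_cons, Multiset.sum_cons]
          push_cast
          ring_nf

end RootsOfDerivatives

section WeakConvergence

open scoped BoundedContinuousFunction ComplexConjugate

variable {ι : Type*} {l : Filter ι}

theorem tendsto_of_tendsto_integral_pow_mul_conj_pow_of_injective {E : Type*} [TopologicalSpace E]
    [CompactSpace E] [PolishSpace E] [MeasurableSpace E] [BorelSpace E] {f : C(E, ℂ)}
    (hf : Function.Injective f) {ν : ι → ProbabilityMeasure E} {μ : ProbabilityMeasure E}
    (h : ∀ a b : ℕ, Tendsto (fun i => ∫ x, f x ^ a * conj (f x) ^ b ∂(ν i : Measure E)) l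
      (𝓝 (∫ x, f x ^ a * conj (f x) ^ b ∂(μ : Measure E)))) :
    Tendsto ν l (𝓝 μ) := by
  let f' : E →ᵇ ℂ := BoundedContinuousFunction.mkOfCompact f
  have hint (ρ : ProbabilityMeasure E) (g : E →ᵇ ℂ) : Integrable g (ρ : Measure E) :=
    g.integrable _
  refine ProbabilityMeasure.tendsto_of_tight_of_separatesPoints ℂ IsTightMeasureSet.of_compactSpace
    (A := StarAlgebra.adjoin ℂ {f'}) ?_ fun g hg => ?_
  · intro x y hxy
    exact ⟨f, ⟨f, ⟨f', StarAlgebra.self_mem_adjoin_singleton ℂ f', rfl⟩, rfl⟩,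
      hf.ne hxy⟩
  · have hspan : g ∈ Submodule.span ℂ (Submonoid.closure {f', star f'} : Set (E →ᵇ ℂ)) := by
      rw [← Set.singleton_union, ← Set.star_singleton, ← StarAlgebra.adjoin_eq_span]
      exact hg
    clear hg
    induction hspan using Submodule.span_induction with
    | mem g hg =>
      obtain ⟨a, b, rfl⟩ := (Submonoid.mem_closure_pair _ _ _).1 hg
      exact h a b
    | zero => simpa using tendsto_const_nhds
    | add g₁ g₂ _ _ h₁ h₂ =>
      simpa [integral_add (hint _ g₁) (hint _ g₂)] using h₁.add h₂
    | smul c g _ h => simpa [integral_const_mul] using h.const_mul c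

theorem tendsto_of_tendsto_integral_pow_mul_conj_pow {K : Set ℂ} (hK : IsCompact K)
    {ν : ι → ProbabilityMeasure ℂ} {μ : ProbabilityMeasure ℂ}
    (hν : ∀ i, ∀ᵐ z ∂(ν i : Measure ℂ), z ∈ K) (hμ : ∀ᵐ z ∂(μ : Measure ℂ), z ∈ K)
    (h : ∀ a b : ℕ, Tendsto (fun i => ∫ z, z ^ a * conj z ^ b ∂(ν i : Measure ℂ)) l
      (𝓝 (∫ z, z ^ a * conj z ^ b ∂(μ : Measure ℂ)))) :
    Tendsto ν l (𝓝 μ) := by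
  have : CompactSpace K := isCompact_iff_compactSpace.1 hK
  have hemb : MeasurableEmbedding (Subtype.val : K → ℂ) :=
    MeasurableEmbedding.subtype_coe hK.measurableSet
  let val : C(K, ℂ) := ⟨Subtype.val, continuous_subtype_val⟩
  have hlift (ρ : ProbabilityMeasure ℂ) (hρ : ∀ᵐ z ∂(ρ : Measure ℂ), z ∈ K) :
      ∃ ρ' : ProbabilityMeasure K, ρ'.map val.continuous.aemeasurable = ρ := by
    have : IsProbabilityMeasure ((ρ : Measure ℂ).comap (Subtype.val : K → ℂ)) :=
      hemb.isProbabilityMeasure_comap (by simpa using hρ)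
    refine ⟨⟨(ρ : Measure ℂ).comap Subtype.val, this⟩, Subtype.ext ?_⟩
    exact (hemb.map_comap _).trans (Measure.restrict_eq_self_of_ae_mem (by simpa using hρ))
  choose ν' hν' using fun i => hlift (ν i) (hν i)
  obtain ⟨μ', hμ'⟩ := hlift μ hμ
  rw [← hμ', ← funext hν']
  refine ProbabilityMeasure.tendsto_map_of_tendsto_of_continuous ν' μ' ?_ val.continuous
  refine tendsto_of_tendsto_integral_pow_mul_conj_pow_of_injective (f := val)
    Subtype.val_injective fun a b => ?_
  have hmap (ρ : ProbabilityMeasure K) :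
      ∫ x, val x ^ a * conj (val x) ^ b ∂(ρ : Measure K) =
        ∫ z, z ^ a * conj z ^ b ∂(ρ.map val.continuous.aemeasurable : Measure ℂ) :=
    (hemb.integral_map fun z => z ^ a * conj z ^ b).symm
  simpa only [hmap, hν', hμ'] using h a b

theorem norm_pow_mul_conj_pow_sub_pow_le {z : ℂ} (hz : ‖z‖ ≤ 1) (j b : ℕ) :
    ‖z ^ (j + b) * conj z ^ b - z ^ j‖ ≤ 2 * b * (1 - ‖z‖) := by
  have hfactor : z ^ (j + b) * conj z ^ b - z ^ j =
      -(z ^ j * ((1 - ‖z‖ ^ (2 * b) : ℝ) : ℂ)) := by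
    rw [pow_add, mul_assoc, ← mul_pow, Complex.mul_conj, Complex.normSq_eq_norm_sq]
    push_cast
    ring
  have hle : ‖z‖ ^ (2 * b) ≤ 1 := pow_le_one₀ (norm_nonneg z) hz
  have hbernoulli := one_add_mul_le_pow (a := ‖z‖ - 1) (by linarith [norm_nonneg z]) (2 * b)
  rw [add_sub_cancel] at hbernoulli
  push_cast at hbernoulli
  calc ‖z ^ (j + b) * conj z ^ b - z ^ j‖ = ‖z‖ ^ j * (1 - ‖z‖ ^ (2 * b)) := by
        rw [hfactor, norm_neg, norm_mul, norm_pow, Complex.norm_real,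
          Real.norm_of_nonneg (sub_nonneg.2 hle)]
    _ ≤ 1 - ‖z‖ ^ (2 * b) :=
        mul_le_of_le_one_left (sub_nonneg.2 hle) (pow_le_one₀ (norm_nonneg z) hz)
    _ ≤ 2 * b * (1 - ‖z‖) := by linarith

theorem norm_integral_pow_mul_conj_pow_sub_integral_pow_le {ρ : Measure ℂ}
    [IsProbabilityMeasure ρ] (hρ : ∀ᵐ z ∂ρ, ‖z‖ ≤ 1) (j b : ℕ) :
    ‖∫ z, z ^ (j + b) * conj z ^ b ∂ρ - ∫ z, z ^ j ∂ρ‖ ≤ 2 * b * (1 - ∫ z, ‖z‖ ∂ρ) := by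
  have hint {F : Type} [NormedAddCommGroup F] {g : ℂ → F} (hg : AEStronglyMeasurable g ρ)
      (hbound : ∀ z, ‖z‖ ≤ 1 → ‖g z‖ ≤ 1) : Integrable g ρ :=
    .of_bound hg 1 (hρ.mono hbound)
  have hnorm : Integrable (fun z : ℂ => ‖z‖) ρ := hint (by fun_prop) (by simp)
  rw [← integral_sub
    (hint (by fun_prop) fun z hz => by
      simpa using mul_le_one₀ (pow_le_one₀ (norm_nonneg z) hz) (by positivity)
        (pow_le_one₀ (norm_nonneg z) hz))
    (hint (by fun_prop) fun z hz => by simpa using pow_le_one₀ (norm_nonneg z) hz)]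
  calc ‖∫ z, z ^ (j + b) * conj z ^ b - z ^ j ∂ρ‖ ≤ ∫ z, 2 * b * (1 - ‖z‖) ∂ρ :=
        norm_integral_le_of_norm_le (((integrable_const 1).sub hnorm).const_mul _)
          (hρ.mono fun z hz => norm_pow_mul_conj_pow_sub_pow_le hz j b)
    _ = 2 * b * (1 - ∫ z, ‖z‖ ∂ρ) := by
        rw [integral_const_mul, integral_sub (integrable_const 1) hnorm]
        simp

theorem tendsto_of_tendsto_integral_pow_of_tendsto_integral_norm {ν : ι → ProbabilityMeasure ℂ}
    {μ : ProbabilityMeasure ℂ} (hν : ∀ i, ∀ᵐ z ∂(ν i : Measure ℂ), ‖z‖ ≤ 1)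
    (hμ : ∀ᵐ z ∂(μ : Measure ℂ), ‖z‖ = 1)
    (hpow : ∀ m : ℕ, Tendsto (fun i => ∫ z, z ^ m ∂(ν i : Measure ℂ)) l
      (𝓝 (∫ z, z ^ m ∂(μ : Measure ℂ))))
    (hnorm : Tendsto (fun i => ∫ z, ‖z‖ ∂(ν i : Measure ℂ)) l (𝓝 1)) :
    Tendsto ν l (𝓝 μ) := by
  refine tendsto_of_tendsto_integral_pow_mul_conj_pow (isCompact_closedBall 0 1)
    (by simpa using hν) (by simpa using hμ.mono fun z hz => hz.le) fun a b => ?_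
  wlog hba : b ≤ a generalizing a b
  · have h := (Complex.continuous_conj.tendsto _).comp (this b a (by lia))
    simpa [Function.comp_def, ← integral_conj, mul_comm] using h
  obtain ⟨j, rfl⟩ := Nat.exists_eq_add_of_le' hba
  have hμnorm : ∫ z, ‖z‖ ∂(μ : Measure ℂ) = 1 := by
    rw [integral_congr_ae hμ]
    simp
  have hμmoment : ∫ z, z ^ (j + b) * conj z ^ b ∂(μ : Measure ℂ) = ∫ z, z ^ j ∂(μ : Measure ℂ) := by
    have h := norm_integral_pow_mul_conj_pow_sub_integral_pow_le
      (hμ.mono fun z hz => hz.le) j b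
    rwa [hμnorm, sub_self, mul_zero, norm_le_zero_iff, sub_eq_zero] at h
  have hdiff : Tendsto (fun i => ∫ z, z ^ (j + b) * conj z ^ b ∂(ν i : Measure ℂ) -
      ∫ z, z ^ j ∂(ν i : Measure ℂ)) l (𝓝 0) := by
    refine squeeze_zero_norm
      (fun i => norm_integral_pow_mul_conj_pow_sub_integral_pow_le (hν i) j b) ?_
    simpa using (hnorm.const_sub 1).const_mul (2 * b : ℝ)
  simpa [hμmoment] using hdiff.add (hpow j)

end WeakConvergence

section Averages

/-- A sequence of reals decays at most subexponentially: for every `ε > 0` it eventually dominates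
`exp (-ε n)`. For the coefficients of a random polynomial this excludes exponential cancellation. -/
def SubexponentialDecay (u : ℕ → ℝ) : Prop :=
  ∀ ε > 0, ∀ᶠ n : ℕ in atTop, Real.exp (-(ε * n)) ≤ u n

theorem SubexponentialDecay.of_eventually_le_pow_mul {u v : ℕ → ℝ} (hu : SubexponentialDecay u)
    (k : ℕ) (huv : ∀ᶠ n : ℕ in atTop, u n ≤ n ^ k * v n) : SubexponentialDecay v := by
  intro ε hε
  have hpow : ∀ᶠ n : ℕ in atTop, (n : ℝ) ^ k ≤ Real.exp (ε / 2 * n) := by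
    have h := tendsto_natCast_atTop_atTop.eventually
      ((isLittleO_pow_exp_pos_mul_atTop k (half_pos hε)).bound one_pos)
    filter_upwards [h] with n hn
    simpa using hn
  filter_upwards [hu (ε / 2) (half_pos hε), hpow, huv, eventually_gt_atTop 0]
    with n hun hpown huvn hn
  have hnk : (0 : ℝ) < n ^ k := by positivity
  have hmul := hun.trans huvn
  have hv : 0 ≤ v n := (pos_of_mul_pos_right ((Real.exp_pos _).trans_le hmul) hnk.le).le
  calc Real.exp (-(ε * n)) = Real.exp (-(ε / 2 * n)) / Real.exp (ε / 2 * n) := by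
        rw [← Real.exp_sub]
        congr 1
        ring
    _ ≤ v n := by
        rw [div_le_iff₀' (Real.exp_pos _)]
        exact hmul.trans (mul_le_mul_of_nonneg_right hpown hv)

theorem tendsto_inv_natCast_sub_smul {E : Type*} [NormedAddCommGroup E] [NormedSpace ℝ E]
    {u : ℕ → E} {L : E} (k : ℕ) (hu : Tendsto (fun n : ℕ => (n : ℝ)⁻¹ • u n) atTop (𝓝 L)) :
    Tendsto (fun n : ℕ => ((n - k : ℕ) : ℝ)⁻¹ • u n) atTop (𝓝 L) := by
  have h := (tendsto_natCast_div_add_atTop (-k : ℝ)).smul hu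
  rw [one_smul] at h
  refine h.congr' ?_
  filter_upwards [eventually_gt_atTop k] with n hn
  have hn0 : (n : ℝ) ≠ 0 := by exact_mod_cast (by lia : n ≠ 0)
  rw [smul_smul, Nat.cast_sub hn.le, ← sub_eq_add_neg, div_mul_eq_mul_div, mul_inv_cancel₀ hn0,
    one_div]

end Averages

section EmpiricalMeasure

variable {α : Type*} [MeasurableSpace α]

theorem integrable_sum_map_dirac [MeasurableSingletonClass α] {E : Type*} [NormedAddCommGroup E]
    (s : Multiset α) (f : α → E) : Integrable f (s.map Measure.dirac).sum := by
  induction s using Multiset.induction_on with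
  | empty => simp
  | cons a s ih =>
    rw [Multiset.map_cons, Multiset.sum_cons]
    exact (integrable_dirac enorm_lt_top).add_measure ih

theorem integral_sum_map_dirac [MeasurableSingletonClass α] {E : Type*} [NormedAddCommGroup E]
    [NormedSpace ℝ E] [CompleteSpace E] (s : Multiset α) (f : α → E) :
    ∫ x, f x ∂(s.map Measure.dirac).sum = (s.map f).sum := by
  induction s using Multiset.induction_on with
  | empty => simp
  | cons a s ih =>
    simp only [Multiset.map_cons, Multiset.sum_cons]
    rw [integral_add_measure (integrable_dirac enorm_lt_top) (integrable_sum_map_dirac s f), ih,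
      integral_dirac]

theorem ae_sum_map_dirac {s : Multiset α} {p : α → Prop} (hp : MeasurableSet {x | p x})
    (hs : ∀ a ∈ s, p a) : ∀ᵐ x ∂(s.map Measure.dirac).sum, p x := by
  induction s using Multiset.induction_on with
  | empty => simp
  | cons a s ih =>
    rw [Multiset.map_cons, Multiset.sum_cons, ae_add_measure_iff, ae_dirac_iff hp]
    exact ⟨hs a (Multiset.mem_cons_self a s), ih fun b hb => hs b (Multiset.mem_cons_of_mem hb)⟩

variable {Ω : Type*} {Z : ℕ → Ω → ℂ} {k : ℕ} {ω : Ω}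

theorem integral_empiricalMeasure {E : Type*} [NormedAddCommGroup E] [NormedSpace ℝ E]
    [CompleteSpace E] {n : ℕ} (hkn : k < n) (f : ℂ → E) :
    ∫ z, f z ∂(empiricalMeasure Z k n hkn ω : Measure ℂ) =
      ((n - k : ℕ) : ℝ)⁻¹ • ((derivZeros Z k n ω).map f).sum := by
  rw [← integral_sum_map_dirac]
  refine (integral_smul_measure f _).trans ?_
  rw [ENNReal.toReal_inv, ENNReal.toReal_natCast]

theorem ae_empiricalMeasure {n : ℕ} (hkn : k < n) {p : ℂ → Prop} (hp : MeasurableSet {z | p z})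
    (h : ∀ a ∈ derivZeros Z k n ω, p a) :
    ∀ᵐ z ∂(empiricalMeasure Z k n hkn ω : Measure ℂ), p z :=
  Measure.ae_smul_measure (ae_sum_map_dirac hp h) _

theorem natDegree_randomPoly (Z : ℕ → Ω → ℂ) (n : ℕ) (ω : Ω) :
    (randomPoly Z n ω).natDegree = n := by
  simp [randomPoly]

theorem monic_randomPoly (Z : ℕ → Ω → ℂ) (n : ℕ) (ω : Ω) : (randomPoly Z n ω).Monic :=
  monic_prod_of_monic _ _ fun _ _ => monic_X_sub_C _

theorem roots_randomPoly (Z : ℕ → Ω → ℂ) (n : ℕ) (ω : Ω) :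
    (randomPoly Z n ω).roots = (Multiset.range n).map fun i => Z i ω := by
  rw [randomPoly, roots_prod _ _ (monic_randomPoly Z n ω).ne_zero]
  simp [Multiset.bind_singleton]

theorem powerSum_roots_randomPoly (Z : ℕ → Ω → ℂ) (n : ℕ) (ω : Ω) (m : ℕ) :
    powerSum (randomPoly Z n ω).roots m = ∑ i ∈ Finset.range n, Z i ω ^ m := by
  rw [roots_randomPoly, powerSum, Multiset.map_map]
  rfl

theorem norm_le_one_of_mem_roots_randomPoly (hZ : ∀ i, ‖Z i ω‖ ≤ 1) (n : ℕ) :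
    ∀ a ∈ (randomPoly Z n ω).roots, ‖a‖ ≤ 1 := by
  simpa [roots_randomPoly] using fun i _ => hZ i

theorem norm_le_one_of_mem_derivZeros (hZ : ∀ i, ‖Z i ω‖ ≤ 1) (k n : ℕ) :
    ∀ a ∈ derivZeros Z k n ω, ‖a‖ ≤ 1 :=
  norm_le_one_of_mem_roots_iterate_derivative (norm_le_one_of_mem_roots_randomPoly hZ n) k

theorem tendsto_average_norm_derivZeros (hZ : ∀ i, ‖Z i ω‖ ≤ 1)
    (hcoeff : SubexponentialDecay fun n => ‖(randomPoly Z n ω).coeff k‖) :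
    Tendsto (fun n : ℕ => ((n - k : ℕ) : ℝ)⁻¹ • ((derivZeros Z k n ω).map (‖·‖)).sum) atTop
      (𝓝 1) := by
  have hprod : SubexponentialDecay fun n => ‖(derivZeros Z k n ω).prod‖ := by
    refine hcoeff.of_eventually_le_pow_mul k ?_
    filter_upwards [eventually_ge_atTop k] with n hn
    simpa only [natDegree_randomPoly, derivZeros] using
      norm_coeff_le_mul_norm_prod_roots_iterate_derivative (monic_randomPoly Z n ω)
        (by rwa [natDegree_randomPoly])
  refine tendsto_order.2 ⟨fun a ha => ?_, fun a ha => ?_⟩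
  · filter_upwards [hprod ((1 - a) / 3) (by linarith), eventually_gt_atTop (2 * k)] with n hexp hn
    have hdeficit : (n - k : ℕ) - ((derivZeros Z k n ω).map (‖·‖)).sum ≤ (1 - a) / 3 * n := by
      have h := hexp.trans (norm_multiset_prod_le_exp _)
      rw [Real.exp_le_exp, card_derivZeros] at h
      linarith
    have hpos : (0 : ℝ) < (n - k : ℕ) := by exact_mod_cast (by lia : 0 < n - k)
    have hle : (n : ℝ) ≤ 2 * (n - k : ℕ) := by exact_mod_cast (by lia : n ≤ 2 * (n - k))
    rw [smul_eq_mul, inv_mul_eq_div, lt_div_iff₀ hpos]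
    nlinarith
  · filter_upwards [eventually_gt_atTop k] with n hn
    have hpos : (0 : ℝ) < (n - k : ℕ) := by exact_mod_cast (by lia : 0 < n - k)
    have hsum : ((derivZeros Z k n ω).map (‖·‖)).sum ≤ (n - k : ℕ) := by
      have h := Multiset.sum_le_card_nsmul ((derivZeros Z k n ω).map (‖·‖)) 1
        (by simpa using norm_le_one_of_mem_derivZeros hZ k n)
      simpa [card_derivZeros] using h
    rw [smul_eq_mul, inv_mul_eq_div]
    exact ((div_le_one hpos).2 hsum).trans_lt ha

theorem tendsto_average_powerSum_derivZeros (hZ : ∀ i, ‖Z i ω‖ ≤ 1) {m : ℕ} {L : ℂ}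
    (havg : Tendsto (fun n : ℕ => (n : ℝ)⁻¹ • ∑ i ∈ Finset.range n, Z i ω ^ m) atTop (𝓝 L)) :
    Tendsto (fun n : ℕ => ((n - k : ℕ) : ℝ)⁻¹ • powerSum (derivZeros Z k n ω) m) atTop (𝓝 L) := by
  refine tendsto_inv_natCast_sub_smul k ?_
  have hdiff : Tendsto (fun n : ℕ => (n : ℝ)⁻¹ •
      (powerSum (randomPoly Z n ω).roots m - powerSum (derivZeros Z k n ω) m)) atTop (𝓝 0) := by
    refine squeeze_zero_norm' ?_
      (tendsto_const_div_atTop_nhds_zero_nat (k * ((2 : ℝ) ^ (m + 1) - 1)))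
    filter_upwards [eventually_ge_atTop k] with n hn
    rw [norm_smul, norm_inv, RCLike.norm_natCast, inv_mul_eq_div]
    gcongr
    exact norm_powerSum_roots_iterate_derivative_sub_le (norm_le_one_of_mem_roots_randomPoly hZ n)
      m (by rwa [natDegree_randomPoly])
  simpa [powerSum_roots_randomPoly, smul_sub] using havg.sub hdiff

theorem tendsto_empiricalMeasure {μ : ProbabilityMeasure ℂ} (hμ : ∀ᵐ z ∂(μ : Measure ℂ), ‖z‖ = 1)
    (hZ : ∀ i, ‖Z i ω‖ ≤ 1)
    (havg : ∀ m : ℕ, Tendsto (fun n : ℕ => (n : ℝ)⁻¹ • ∑ i ∈ Finset.range n, Z i ω ^ m) atTop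
      (𝓝 (∫ z, z ^ m ∂(μ : Measure ℂ))))
    (hcoeff : SubexponentialDecay fun n => ‖(randomPoly Z n ω).coeff k‖) :
    Tendsto (fun m : ℕ => empiricalMeasure Z k (k + 1 + m) (Nat.le_add_right (k + 1) m) ω) atTop
      (𝓝 μ) := by
  have hshift : Tendsto (fun m : ℕ => k + 1 + m) atTop atTop :=
    tendsto_atTop_mono (fun m => Nat.le_add_left m (k + 1)) tendsto_id
  refine tendsto_of_tendsto_integral_pow_of_tendsto_integral_norm (fun m => ?_) hμ
    (fun m => ?_) ?_
  · exact ae_empiricalMeasure _ (measurableSet_le measurable_norm measurable_const)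
      (norm_le_one_of_mem_derivZeros hZ k _)
  · simp only [integral_empiricalMeasure]
    exact (tendsto_average_powerSum_derivZeros hZ (havg m)).comp hshift
  · simp only [integral_empiricalMeasure]
    exact (tendsto_average_norm_derivZeros hZ hcoeff).comp hshift

end EmpiricalMeasure

section Concentration

variable {E : Type*} [PseudoMetricSpace E] [MeasurableSpace E]

/-- The Lévy concentration function of a measure: the supremum of the masses of the closed balls of
radius `r`. Its decay as `r` tends to zero quantifies how diffuse the measure is. -/
noncomputable def levyConcentration (μ : Measure E) (r : ℝ) : ENNReal :=
  ⨆ x, μ (Metric.closedBall x r)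

theorem measure_closedBall_le_levyConcentration (μ : Measure E) (x : E) (r : ℝ) :
    μ (Metric.closedBall x r) ≤ levyConcentration μ r :=
  le_iSup (fun x => μ (Metric.closedBall x r)) x

theorem levyConcentration_mono (μ : Measure E) : Monotone (levyConcentration μ) :=
  fun _ _ h => iSup_mono fun _ => measure_mono (Metric.closedBall_subset_closedBall h)

theorem measure_norm_sub_mul_le_levyConcentration {μ : Measure ℂ} (hμ : ∀ᵐ z ∂μ, ‖z‖ = 1) (a : ℂ)
    {b : ℂ} {δ : ℝ} (hδ : 0 < δ) (hb : δ ≤ ‖b‖) :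
    μ {z | ‖b - z * a‖ ≤ δ ^ 2} ≤ levyConcentration μ δ := by
  have hb0 : b ≠ 0 := norm_pos_iff.1 (hδ.trans_le hb)
  refine (measure_mono_ae ?_).trans
    (measure_closedBall_le_levyConcentration μ (starRingEnd ℂ (a / b)) δ)
  filter_upwards [hμ] with z hz hza
  have hconj : z * starRingEnd ℂ z = 1 := by simp [Complex.mul_conj, Complex.normSq_eq_norm_sq, hz]
  have hfactor : b - z * a = z * (b * (starRingEnd ℂ z - a / b)) := by
    field_simp
    linear_combination -b * hconj
  have hnorm : ‖b - z * a‖ = ‖b‖ * ‖z - starRingEnd ℂ (a / b)‖ := by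
    rw [hfactor, norm_mul, hz, one_mul, norm_mul, ← Complex.norm_conj (starRingEnd ℂ z - a / b),
      map_sub, Complex.conj_conj]
  refine mem_closedBall_iff_norm.2 (le_of_mul_le_mul_left ?_ hδ)
  calc δ * ‖z - starRingEnd ℂ (a / b)‖ ≤ ‖b‖ * ‖z - starRingEnd ℂ (a / b)‖ := by gcongr
    _ ≤ δ * δ := by rw [← hnorm, ← sq]; exact hza

end Concentration

section RandomCoefficients

theorem measurable_coeff_prod_X_sub_C {α ι : Type*} [MeasurableSpace α] (s : Finset ι)
    {g : ι → α → ℂ} (hg : ∀ i, Measurable (g i)) (k : ℕ) :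
    Measurable fun a => (∏ i ∈ s, (X - C (g i a))).coeff k := by
  classical
  induction s using Finset.induction_on generalizing k with
  | empty => simp
  | insert i s hi ih =>
    simp only [Finset.prod_insert hi, sub_mul, coeff_sub, coeff_C_mul]
    refine Measurable.sub ?_ ((hg i).mul (ih k))
    rcases k with _ | k
    · simp
    · simpa only [coeff_X_mul] using ih k

theorem coeff_succ_randomPoly_succ {Ω : Type*} (Z : ℕ → Ω → ℂ) (n k : ℕ) (ω : Ω) :
    (randomPoly Z (n + 1) ω).coeff (k + 1) =
      (randomPoly Z n ω).coeff k - Z n ω * (randomPoly Z n ω).coeff (k + 1) := by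
  rw [randomPoly, Finset.prod_range_succ, ← randomPoly, mul_sub, coeff_sub, coeff_mul_X,
    coeff_mul_C, mul_comm]

variable {Ω : Type*} [MeasurableSpace Ω] {P : Measure Ω}

theorem measure_preimage_prodMk_le_of_indepFun [IsProbabilityMeasure P] {α β : Type*}
    [MeasurableSpace α] [MeasurableSpace β] {Y : Ω → α} {W : Ω → β} (hYW : IndepFun Y W P)
    (hY : Measurable Y) (hW : Measurable W) {E : Set (α × β)} (hE : MeasurableSet E) {c : ENNReal}
    (hc : ∀ y, P.map W (Prod.mk y ⁻¹' E) ≤ c) : P ((fun ω => (Y ω, W ω)) ⁻¹' E) ≤ c := by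
  have : IsProbabilityMeasure (P.map Y) := Measure.isProbabilityMeasure_map hY.aemeasurable
  have : IsProbabilityMeasure (P.map W) := Measure.isProbabilityMeasure_map hW.aemeasurable
  rw [← Measure.map_apply (hY.prodMk hW) hE,
    (indepFun_iff_map_prod_eq_prod_map_map hY.aemeasurable hW.aemeasurable).1 hYW,
    Measure.prod_apply hE]
  simpa using lintegral_mono (μ := P.map Y) hc

variable {Z : ℕ → Ω → ℂ} (hZ : ∀ i, Measurable (Z i))

include hZ

theorem measurable_coeff_randomPoly (n k : ℕ) :
    Measurable fun ω => (randomPoly Z n ω).coeff k :=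
  measurable_coeff_prod_X_sub_C _ hZ k

theorem indepFun_coeff_randomPoly (hindep : iIndepFun Z P) (n j k : ℕ) :
    IndepFun (fun ω => ((randomPoly Z n ω).coeff j, (randomPoly Z n ω).coeff k)) (Z n) P := by
  let c (k : ℕ) (x : Finset.range n → ℂ) : ℂ := (∏ i, (X - C (x i))).coeff k
  have hc (k : ℕ) : Measurable (c k) :=
    measurable_coeff_prod_X_sub_C Finset.univ measurable_pi_apply k
  have hcoeff (k : ℕ) (ω : Ω) : c k (fun i => Z i ω) = (randomPoly Z n ω).coeff k :=
    congrArg (coeff · k) (Finset.prod_coe_sort (Finset.range n) fun i => X - C (Z i ω))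
  have h := (hindep.indepFun_finset (Finset.range n) {n} (by simp) hZ).comp
    ((hc j).prodMk (hc k)) (measurable_pi_apply ⟨n, Finset.mem_singleton_self n⟩)
  simpa only [Function.comp_def, hcoeff] using h

variable {μ : Measure ℂ} (hμ : ∀ᵐ z ∂μ, ‖z‖ = 1) (hlaw : ∀ i, P.map (Z i) = μ)

include hμ hlaw

theorem ae_norm_eq_one : ∀ᵐ ω ∂P, ∀ i, ‖Z i ω‖ = 1 :=
  ae_all_iff.2 fun i => ae_of_ae_map (hZ i).aemeasurable (by rwa [hlaw])

variable [IsProbabilityMeasure P]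

theorem measure_norm_coeff_randomPoly_succ_le (hindep : iIndepFun Z P) {η : ℝ} (hη : 0 < η)
    (n k : ℕ) :
    P {ω | ‖(randomPoly Z (n + 1) ω).coeff (k + 1)‖ ≤ η ^ 2} ≤
      P {ω | ‖(randomPoly Z n ω).coeff k‖ ≤ η} + levyConcentration μ η := by
  let Y (ω : Ω) : ℂ × ℂ := ((randomPoly Z n ω).coeff k, (randomPoly Z n ω).coeff (k + 1))
  have hY : Measurable Y :=
    (measurable_coeff_randomPoly hZ n k).prodMk (measurable_coeff_randomPoly hZ n (k + 1))
  let E : Set ((ℂ × ℂ) × ℂ) := {q | ‖q.1.1 - q.2 * q.1.2‖ ≤ η ^ 2 ∧ η < ‖q.1.1‖}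
  have hE : MeasurableSet E :=
    (measurableSet_le (f := fun q : (ℂ × ℂ) × ℂ => ‖q.1.1 - q.2 * q.1.2‖) (by fun_prop)
      measurable_const).inter
      (measurableSet_lt (g := fun q : (ℂ × ℂ) × ℂ => ‖q.1.1‖) measurable_const (by fun_prop))
  have hsub : {ω | ‖(randomPoly Z (n + 1) ω).coeff (k + 1)‖ ≤ η ^ 2} ⊆
      {ω | ‖(randomPoly Z n ω).coeff k‖ ≤ η} ∪ (fun ω => (Y ω, Z n ω)) ⁻¹' E := by
    intro ω hω
    rw [Set.mem_ofPred_eq, coeff_succ_randomPoly_succ] at hω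
    exact (le_or_gt ‖(randomPoly Z n ω).coeff k‖ η).imp id fun h => ⟨hω, h⟩
  have hE_le : P ((fun ω => (Y ω, Z n ω)) ⁻¹' E) ≤ levyConcentration μ η := by
    refine measure_preimage_prodMk_le_of_indepFun
      (indepFun_coeff_randomPoly hZ hindep n k (k + 1)) hY (hZ n) hE fun y => ?_
    rw [hlaw]
    rcases le_or_gt ‖y.1‖ η with hy | hy
    · simp [E, hy.not_gt]
    · exact (measure_mono fun z hz => hz.1).trans
        (measure_norm_sub_mul_le_levyConcentration hμ y.2 hη hy.le)
  exact (measure_mono hsub).trans ((measure_union_le _ _).trans (by gcongr))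

theorem measure_norm_coeff_randomPoly_le (hindep : iIndepFun Z P) {δ : ℝ} (hδ0 : 0 < δ)
    (hδ1 : δ < 1) {k n : ℕ} (hkn : k ≤ n) :
    P {ω | ‖(randomPoly Z n ω).coeff k‖ ≤ δ ^ 2 ^ k} ≤ k * levyConcentration μ δ := by
  induction k generalizing n with
  | zero =>
    have hae : ∀ᵐ ω ∂P, ¬ ‖(randomPoly Z n ω).coeff 0‖ ≤ δ ^ 2 ^ 0 := by
      filter_upwards [ae_norm_eq_one hZ hμ hlaw] with ω hω
      simpa [coeff_zero_eq_eval_zero, randomPoly, eval_prod, hω] using hδ1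
    rw [Nat.cast_zero, zero_mul, nonpos_iff_eq_zero]
    exact measure_eq_zero_iff_ae_notMem.2 hae
  | succ k ih =>
    obtain ⟨n, rfl⟩ : ∃ m, n = m + 1 := ⟨n - 1, by lia⟩
    calc P {ω | ‖(randomPoly Z (n + 1) ω).coeff (k + 1)‖ ≤ δ ^ 2 ^ (k + 1)}
        ≤ P {ω | ‖(randomPoly Z n ω).coeff k‖ ≤ δ ^ 2 ^ k} +
            levyConcentration μ (δ ^ 2 ^ k) := by
          rw [pow_succ, pow_mul]
          exact measure_norm_coeff_randomPoly_succ_le hZ hμ hlaw hindep (by positivity) n k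
      _ ≤ k * levyConcentration μ δ + levyConcentration μ δ :=
          add_le_add (ih (by lia))
            (levyConcentration_mono μ (pow_le_of_le_one hδ0.le hδ1.le (by positivity)))
      _ = (k + 1 : ℕ) * levyConcentration μ δ := by rw [Nat.cast_succ, add_one_mul]

theorem ae_eventually_exp_le_norm_coeff_randomPoly (hindep : iIndepFun Z P)
    (hconc : ∀ ε > 0, ∑' n : ℕ, levyConcentration μ (Real.exp (-(ε * n))) ≠ ⊤) (k : ℕ) {ε : ℝ}
    (hε : 0 < ε) :
    ∀ᵐ ω ∂P, ∀ᶠ n : ℕ in atTop, Real.exp (-(ε * n)) ≤ ‖(randomPoly Z n ω).coeff k‖ := by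
  have hle (n : ℕ) : P {ω | k < n ∧ ‖(randomPoly Z n ω).coeff k‖ ≤ Real.exp (-(ε * n))} ≤
      k * levyConcentration μ (Real.exp (-(ε / 2 ^ k * n))) := by
    rcases le_or_gt n k with hn | hn
    · simp [hn.not_gt]
    have hexp : Real.exp (-(ε * n)) = Real.exp (-(ε / 2 ^ k * n)) ^ 2 ^ k := by
      rw [← Real.exp_nat_mul]
      congr 1
      push_cast
      field_simp
    have hneg : -(ε / 2 ^ k * n) < 0 := by
      have : (0 : ℝ) < n := by exact_mod_cast Nat.zero_lt_of_lt hn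
      rw [neg_lt_zero]
      positivity
    simpa only [hn, true_and, hexp] using measure_norm_coeff_randomPoly_le hZ hμ hlaw hindep
      (Real.exp_pos _) (Real.exp_lt_one_iff.2 hneg) hn.le
  have hsum : ∑' n : ℕ, P {ω | k < n ∧ ‖(randomPoly Z n ω).coeff k‖ ≤ Real.exp (-(ε * n))} ≠ ⊤ := by
    refine ne_top_of_le_ne_top ?_ (ENNReal.tsum_le_tsum hle)
    rw [ENNReal.tsum_mul_left]
    exact ENNReal.mul_ne_top (ENNReal.natCast_ne_top k) (hconc _ (by positivity))
  filter_upwards [ae_eventually_notMem hsum] with ω hω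
  filter_upwards [hω, eventually_gt_atTop k] with n hn hkn
  exact (not_le.1 fun h => hn ⟨hkn, h⟩).le

theorem ae_subexponentialDecay_norm_coeff_randomPoly (hindep : iIndepFun Z P)
    (hconc : ∀ ε > 0, ∑' n : ℕ, levyConcentration μ (Real.exp (-(ε * n))) ≠ ⊤) (k : ℕ) :
    ∀ᵐ ω ∂P, SubexponentialDecay fun n => ‖(randomPoly Z n ω).coeff k‖ := by
  have h := ae_all_iff.2 fun q : ℕ => ae_eventually_exp_le_norm_coeff_randomPoly hZ hμ hlaw hindep
    hconc k (ε := 1 / (q + 1)) (by positivity)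
  filter_upwards [h] with ω hω ε hε
  obtain ⟨q, hq⟩ := exists_nat_one_div_lt hε
  filter_upwards [hω q] with n hn
  refine le_trans ?_ hn
  gcongr

theorem ae_tendsto_average_pow (hindep : iIndepFun Z P) (m : ℕ) :
    ∀ᵐ ω ∂P, Tendsto (fun n : ℕ => (n : ℝ)⁻¹ • ∑ i ∈ Finset.range n, Z i ω ^ m) atTop
      (𝓝 (∫ z, z ^ m ∂μ)) := by
  have hpow : Measurable fun z : ℂ => z ^ m := by fun_prop
  have hint : Integrable (fun ω => Z 0 ω ^ m) P := by
    refine .of_bound ((hZ 0).pow_const m).aestronglyMeasurable 1 ?_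
    filter_upwards [ae_norm_eq_one hZ hμ hlaw] with ω hω
    rw [norm_pow, hω, one_pow]
  have hident (i : ℕ) : IdentDistrib (Z i) (Z 0) P P :=
    ⟨(hZ i).aemeasurable, (hZ 0).aemeasurable, by rw [hlaw, hlaw]⟩
  rw [← hlaw 0, integral_map (hZ 0).aemeasurable hpow.aestronglyMeasurable]
  exact strong_law_ae (fun i ω => Z i ω ^ m) hint
    (fun i j hij => (hindep.indepFun hij).comp hpow hpow) fun i => (hident i).comp hpow

end RandomCoefficients

section UniformCircle

theorem coe_uniformCircle : (uniformCircle : Measure ℂ) =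
    (volume[|Set.Ioc (0 : ℝ) (2 * Real.pi)]).map fun θ : ℝ => Complex.exp (θ * Complex.I) :=
  rfl

theorem ae_norm_eq_one_uniformCircle : ∀ᵐ z ∂(uniformCircle : Measure ℂ), ‖z‖ = 1 := by
  rw [coe_uniformCircle,
    ae_map_iff (by fun_prop) (measurableSet_eq_fun (by fun_prop) (by fun_prop))]
  exact Eventually.of_forall Complex.norm_exp_ofReal_mul_I

theorem dist_coe_addCircle_le (θ φ : ℝ) :
    dist (θ : AddCircle (2 * Real.pi)) φ ≤
      Real.pi / 2 * dist (Complex.exp (θ * Complex.I)) (Complex.exp (φ * Complex.I)) := by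
  have hcoe : ((toIocMod Real.two_pi_pos (-Real.pi) (θ - φ) : ℝ) : AddCircle (2 * Real.pi)) =
      θ - φ := by
    rw [toIocMod, AddCircle.coe_sub, AddCircle.coe_zsmul, AddCircle.coe_period, smul_zero, sub_zero,
      AddCircle.coe_sub]
  calc dist (θ : AddCircle (2 * Real.pi)) φ
      ≤ |toIocMod Real.two_pi_pos (-Real.pi) (θ - φ)| := by
        rw [dist_eq_norm, ← hcoe]
        exact QuotientAddGroup.norm_mk_le_norm
    _ = InnerProductGeometry.angle (Complex.exp (θ * Complex.I)) (Complex.exp (φ * Complex.I)) :=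
        (Complex.angle_exp_exp θ φ).symm
    _ ≤ _ := by
        rw [dist_eq_norm]
        exact Complex.angle_le_mul_norm_sub (Complex.norm_exp_ofReal_mul_I θ)
          (Complex.norm_exp_ofReal_mul_I φ)

theorem levyConcentration_uniformCircle_le (r : ℝ) :
    levyConcentration (uniformCircle : Measure ℂ) r ≤ ENNReal.ofReal r := by
  refine iSup_le fun x => ?_
  rw [coe_uniformCircle, Measure.map_apply (by fun_prop) Metric.isClosed_closedBall.measurableSet]
  set A := (fun θ : ℝ => Complex.exp (θ * Complex.I)) ⁻¹' Metric.closedBall x r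
  rcases A.eq_empty_or_nonempty with hA | ⟨φ, hφ⟩
  · simp [hA]
  have hsub : A ⊆ (↑) ⁻¹' Metric.closedBall (φ : AddCircle (2 * Real.pi)) (Real.pi * r) := by
    intro θ hθ
    have hchord := (dist_triangle_right _ _ x).trans (add_le_add hθ hφ)
    calc dist (θ : AddCircle (2 * Real.pi)) φ ≤ Real.pi / 2 * (r + r) :=
          (dist_coe_addCircle_le θ φ).trans (by gcongr)
      _ = Real.pi * r := by ring
  have : Fact (0 < 2 * Real.pi) := ⟨Real.two_pi_pos⟩
  have hmk := AddCircle.measurePreserving_mk (2 * Real.pi) 0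
  rw [zero_add] at hmk
  calc volume[|Set.Ioc (0 : ℝ) (2 * Real.pi)] A
      ≤ (volume (Set.Ioc (0 : ℝ) (2 * Real.pi)))⁻¹ *
          volume (Metric.closedBall (φ : AddCircle (2 * Real.pi)) (Real.pi * r)) := by
        rw [← hmk.measure_preimage Metric.isClosed_closedBall.nullMeasurableSet]
        exact mul_le_mul_right (measure_mono hsub) _
    _ ≤ (ENNReal.ofReal (2 * Real.pi))⁻¹ * ENNReal.ofReal (2 * Real.pi * r) := by
        rw [Real.volume_Ioc, sub_zero, AddCircle.volume_closedBall, ← mul_assoc]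
        gcongr
        exact min_le_right _ _
    _ = ENNReal.ofReal r := by
        rw [ENNReal.ofReal_mul Real.two_pi_pos.le, ← mul_assoc, ENNReal.inv_mul_cancel
          (ENNReal.ofReal_pos.2 Real.two_pi_pos).ne' ENNReal.ofReal_ne_top, one_mul]

theorem tsum_levyConcentration_uniformCircle_ne_top {ε : ℝ} (hε : 0 < ε) :
    ∑' n : ℕ, levyConcentration (uniformCircle : Measure ℂ) (Real.exp (-(ε * n))) ≠ ⊤ := by
  have hsum : Summable fun n : ℕ => Real.exp (-(ε * n)) := by
    simpa only [neg_mul, mul_comm (_ : ℝ) (-ε)] using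
      Real.summable_exp_nat_mul_iff.2 (neg_lt_zero.2 hε)
  exact ne_top_of_le_ne_top hsum.tsum_ofReal_ne_top
    (ENNReal.tsum_le_tsum fun n => levyConcentration_uniformCircle_le _)

end UniformCircle

theorem corollary6_general {Ω : Type*} [MeasurableSpace Ω] (P : Measure Ω) [IsProbabilityMeasure P]
    (Z : ℕ → Ω → ℂ) (hZ : ∀ i, Measurable (Z i)) (hindep : iIndepFun Z P)
    (μ : ProbabilityMeasure ℂ) (hlaw : ∀ i, P.map (Z i) = (μ : Measure ℂ))
    (hμ : ∀ᵐ z ∂(μ : Measure ℂ), ‖z‖ = 1)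
    (hconc : ∀ ε > 0,
      ∑' n : ℕ, levyConcentration (μ : Measure ℂ) (Real.exp (-(ε * n))) ≠ ⊤) (k : ℕ) :
    ∀ᵐ ω ∂P, Tendsto
      (fun m : ℕ => empiricalMeasure Z k (k + 1 + m) (Nat.le_add_right (k + 1) m) ω) atTop
      (𝓝 μ) := by
  filter_upwards [ae_norm_eq_one hZ hμ hlaw,
    ae_all_iff.2 (ae_tendsto_average_pow hZ hμ hlaw hindep),
    ae_subexponentialDecay_norm_coeff_randomPoly hZ hμ hlaw hindep hconc k]
    with ω hnorm havg hcoeff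
  exact tendsto_empiricalMeasure hμ (fun i => (hnorm i).le) havg hcoeff

theorem corollary6 {Ω : Type*} [MeasurableSpace Ω] (P : Measure Ω) [IsProbabilityMeasure P]
    (Z : ℕ → Ω → ℂ) (hZ : ∀ i, Measurable (Z i))
    (hindep : iIndepFun Z P)
    (hlaw : ∀ i, P.map (Z i) = (uniformCircle : Measure ℂ))
    (k : ℕ) (hk : 1 ≤ k) :
    ∀ᵐ ω ∂P, Tendsto
      (fun m : ℕ => empiricalMeasure Z k (k + 1 + m) (by omega) ω) atTop (𝓝 uniformCircle) :=
  corollary6_general P Z hZ hindep uniformCircle hlaw ae_norm_eq_one_uniformCircle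
    (fun _ => tsum_levyConcentration_uniformCircle_ne_top) k
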